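/- Let $d\ge 3$ and $0\le k\le d-1$ be integers with $(d,k)\ne(3,1)$. Then there is a $d$-polytope $P\subset\mathbb{R}^d$ (the convex hull of finitely many points, affinely spanning $\mathbb{R}^d$) that is not weakly $k$-scribable in the spherical sense and not weakly $k$-scribable in the Euclidean sense, where these notions are as follows. Let $\mathbb{S}^d\subset\mathbb{R}^{d+1}$ be the unit sphere, and let $\mathcal S\subset\mathbb{S}^d$ be the set of all $x=(x_0,\dots,x_d)\in\mathbb{S}^d$ with $-x_0^2+x_1^2+\dots+x_d^2=0$ and $x_0\ge 0$. A spherical $d$-polytope is a set $Q=K\cap\mathbb{S}^d$, where $K\subset\mathbb{R}^{d+1}$ is a finitely generated convex cone that contains no line and linearly spans $\mathbb{R}^{d+1}$. Its faces are $\emptyset$, $Q$, and the intersections of $Q$ with linear hyperplanes that have $Q$ on one side; a $k$-face is a face whose linear span has dimension $k+1$. The faces of a Euclidean polytope are likewise $\emptyset$, the polytope itself and its intersections with supporting affine hyperplanes, and a $k$-face is a face whose affine hull has dimension $k$. Face lattices are ordered by inclusion. * $P$ is weakly $k$-scribable in the spherical sense if there is a spherical $d$-polytope $Q$ whose face lattice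 is isomorphic to that of $P$ such that the linear span of every $k$-face of $Q$ meets $\mathcal S$ in exactly one point. * $P$ is weakly $k$-scribable in the Euclidean sense if there is a $d$-polytope $Q\subset\mathbb{R}^d$ whose face lattice is isomorphic to that of $P$, and a sphere in $\mathbb{R}^d$ of positive radius that meets the affine hull of every $k$-face of $Q$ in exactly one point. -/

import Mathlib

/-! ### Polytopes in Euclidean space -/

/-- A (bounded, full-dimensional) convex `d`-polytope in Euclidean `d`-space: the convex hull of
finitely many points that affinely spans the space. -/
def IsPolytope {d : ℕ} (P : Set (EuclideanSpace ℝ (Fin d))) : Prop :=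
  (∃ V : Set (EuclideanSpace ℝ (Fin d)), V.Finite ∧ P = convexHull ℝ V) ∧ affineSpan ℝ P = ⊤

/-- The face lattice of a convex polytope, ordered by inclusion. The faces are the exposed subsets:
the empty face, the polytope itself, and its intersections with supporting hyperplanes. -/
abbrev FaceLattice {d : ℕ} (P : Set (EuclideanSpace ℝ (Fin d))) : Type :=
  {F : Set (EuclideanSpace ℝ (Fin d)) // IsExposed ℝ P F}

/-- `F` is a `k`-dimensional face of `P`. -/
def IsKFace {d : ℕ} (k : ℕ) (P F : Set (EuclideanSpace ℝ (Fin d))) : Prop :=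
  IsExposed ℝ P F ∧ F.Nonempty ∧ Module.finrank ℝ (vectorSpan ℝ F) = k

/-! ### Lorentzian space and spherical polytopes

The space `ℝ^{d+1}` is `EuclideanSpace ℝ (Fin (d + 1))`; the unit sphere in it is the spherical
space `𝕊^d`, and the coordinate with index `0` is the time coordinate of `𝕃^{1,d}`. -/

/-- The Lorentzian scalar product `-x₀y₀ + x₁y₁ + ⋯ + x_d y_d`. -/
def lorentzProd {d : ℕ} (x y : EuclideanSpace ℝ (Fin (d + 1))) : ℝ :=
  -(x 0 * y 0) + ∑ i : Fin d, x i.succ * y i.succ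

/-- The sphere `𝒮 ⊆ 𝕊^d`: the boundary of the spherical cap in which the light cone
`{x | ⟨x, x⟩ ≤ 0, x₀ ≥ 0}` meets `𝕊^d`. -/
def lightSphere (d : ℕ) : Set (EuclideanSpace ℝ (Fin (d + 1))) :=
  {x | x ∈ Metric.sphere 0 1 ∧ lorentzProd x x = 0 ∧ 0 ≤ x 0}

/-- A (full-dimensional) spherical `d`-polytope in `𝕊^d`: the intersection of `𝕊^d` with a
polyhedral (finitely generated) cone that contains no line and spans `ℝ^{d+1}`. -/
def IsSphericalPolytope {d : ℕ} (P : Set (EuclideanSpace ℝ (Fin (d + 1)))) : Prop :=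
  (∃ K : PointedCone ℝ (EuclideanSpace ℝ (Fin (d + 1))),
    K.FG ∧ (∀ x ∈ K, -x ∈ K → x = 0) ∧ P = (K : Set _) ∩ Metric.sphere 0 1) ∧
  Submodule.span ℝ P = ⊤

/-- `F` is a face of the spherical polytope `P`: the intersection of `P` with a linear hyperplane
`φ = 0` that has `P` on one side. The empty face and `P` itself (`φ = 0`) are included. -/
def IsSphericalFace {d : ℕ} (P F : Set (EuclideanSpace ℝ (Fin (d + 1)))) : Prop :=
  ∃ φ : EuclideanSpace ℝ (Fin (d + 1)) →ₗ[ℝ] ℝ, (∀ x ∈ P, 0 ≤ φ x) ∧ F = {x | x ∈ P ∧ φ x = 0}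

/-- The face lattice of a spherical polytope, ordered by inclusion. -/
abbrev SphericalFaceLattice {d : ℕ} (P : Set (EuclideanSpace ℝ (Fin (d + 1)))) : Type :=
  {F : Set (EuclideanSpace ℝ (Fin (d + 1))) // IsSphericalFace P F}

/-- `F` is a face of dimension `k` (as a subset of the sphere) of the spherical polytope `P`. -/
def IsSphericalKFace {d : ℕ} (k : ℕ) (P F : Set (EuclideanSpace ℝ (Fin (d + 1)))) : Prop :=
  IsSphericalFace P F ∧ Module.finrank ℝ (Submodule.span ℝ F) = k + 1

/-! ### Weak scribability -/

/-- A face `F` of a spherical polytope is weakly tangent to `𝒮` if its span meets `𝒮` in exactly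
one point. -/
def IsWeaklyTangent {d : ℕ} (F : Set (EuclideanSpace ℝ (Fin (d + 1)))) : Prop :=
  ∃ t, (Submodule.span ℝ F : Set (EuclideanSpace ℝ (Fin (d + 1)))) ∩ lightSphere d = {t}

/-- A spherical polytope is weakly `k`-scribed if all its `k`-faces are weakly tangent to `𝒮`. -/
def IsWeaklyScribed {d : ℕ} (k : ℕ) (P : Set (EuclideanSpace ℝ (Fin (d + 1)))) : Prop :=
  ∀ F, IsSphericalKFace k P F → IsWeaklyTangent F

/-- The combinatorial type of the `d`-polytope `P` is weakly `k`-scribable in the spherical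
(Lorentzian) sense: some spherical `d`-polytope with the same face lattice is weakly
`k`-scribed. -/
def IsWeaklyScribable {d : ℕ} (k : ℕ) (P : Set (EuclideanSpace ℝ (Fin d))) : Prop :=
  ∃ Q : Set (EuclideanSpace ℝ (Fin (d + 1))), IsSphericalPolytope Q ∧
    Nonempty (FaceLattice P ≃o SphericalFaceLattice Q) ∧ IsWeaklyScribed k Q

/-- The combinatorial type of the `d`-polytope `P` is weakly `k`-scribable in the Euclidean sense
of Schulte: some `d`-polytope in Euclidean `d`-space with the same face lattice has the affine
hulls of all its `k`-faces tangent to one sphere. -/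
def IsEuclideanWeaklyScribable {d : ℕ} (k : ℕ) (P : Set (EuclideanSpace ℝ (Fin d))) : Prop :=
  ∃ Q : Set (EuclideanSpace ℝ (Fin d)), IsPolytope Q ∧
    Nonempty (FaceLattice P ≃o FaceLattice Q) ∧
    ∃ (c : EuclideanSpace ℝ (Fin d)) (r : ℝ), 0 < r ∧ ∀ F, IsKFace k Q F →
      ∃ t, (affineSpan ℝ F : Set (EuclideanSpace ℝ (Fin d))) ∩ Metric.sphere c r = {t}

/-! Both notions of scribability imply one linear condition, `HasTangentRealization`: the faces
become subspaces of Lorentzian space with the same inclusions, and each subspace of dimension `k +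
1` contains a nonzero null vector orthogonal to all of it. In the Euclidean case, `lorentzLift` puts
the space at height `r` above the center of the sphere, so that the sphere lies on the light cone.
Convexity plays no further role.

The obstruction is three-dimensional. A quadric through seven vertices of a cube has an equation
that combines the three products of opposite facets, hence contains the eighth vertex. In the
modified cube `C` the vertex `7` stays on two of the three facets but leaves the third. If all eight
vertices are null, the coefficient of the third product must vanish, and this makes vertices `0` and
`3` orthogonal (`orthogonal_of_incidence`). Orthogonal null vectors are proportional, but a facet
separates these two (`not_null_of_incidence`).

For larger `d`, a 3-polytope is joined with a simplex on `n = d - 3` vertices. If `k ≤ 1`, the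
3-polytope is `C`: fix a simplex face `R` with `k` vertices; the tangent vectors of the joins of `R`
with the vertices of `C` have the incidences of `C`. If `k ≥ 2`, it is the polar of `C` and `R` has
`k - 2` vertices; the joins of `R` with the facets of the polar are hyperplanes in their common
span, and their tangent vectors are poles, which again have the incidences of `C`. All dimensions
are forced by the lengths of flags (`finrank_eq_of_strictMono`). -/

/-! ### Null vectors of the Lorentzian form. -/

/-- The Lorentzian scalar product as a bilinear form. -/
noncomputable def lorentzForm (d : ℕ) : LinearMap.BilinForm ℝ (EuclideanSpace ℝ (Fin (d + 1))) :=
  LinearMap.mk₂ ℝ lorentzProd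
    (fun x y z => by simp [lorentzProd, add_mul, Finset.sum_add_distrib]; ring)
    (fun c x y => by simp [lorentzProd, mul_assoc, ← Finset.mul_sum]; ring)
    (fun x y z => by simp [lorentzProd, mul_add, Finset.sum_add_distrib]; ring)
    (fun c x y => by simp [lorentzProd, mul_left_comm, ← Finset.mul_sum]; ring)

theorem lorentzForm_apply {d : ℕ} (x y : EuclideanSpace ℝ (Fin (d + 1))) :
    lorentzForm d x y = lorentzProd x y := rfl

theorem lorentzForm_comm {d : ℕ} (x y : EuclideanSpace ℝ (Fin (d + 1))) :
    lorentzForm d x y = lorentzForm d y x := by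
  simp [lorentzForm_apply, lorentzProd, mul_comm]

theorem eq_zero_of_lorentzForm_self_eq_zero {d : ℕ} {x : EuclideanSpace ℝ (Fin (d + 1))}
    (hx : lorentzForm d x x = 0) (h0 : x 0 = 0) : x = 0 := by
  rw [lorentzForm_apply, lorentzProd, h0, mul_zero, neg_zero, zero_add,
    Finset.sum_eq_zero_iff_of_nonneg fun i _ => mul_self_nonneg _] at hx
  ext i
  refine Fin.cases h0 (fun j => ?_) i
  exact mul_self_eq_zero.1 (hx j (Finset.mem_univ j))

/-- Orthogonal null vectors are proportional. -/
theorem exists_smul_eq_of_null_of_orthogonal {d : ℕ} {x y : EuclideanSpace ℝ (Fin (d + 1))}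
    (hx : lorentzForm d x x = 0) (hy : lorentzForm d y y = 0) (hxy : lorentzForm d x y = 0)
    (hx0 : x ≠ 0) : ∃ c : ℝ, y = c • x := by
  have h0 : x 0 ≠ 0 := fun h => hx0 (eq_zero_of_lorentzForm_self_eq_zero hx h)
  -- The difference `y - (y 0 / x 0) • x` is null and has time coordinate zero.
  refine ⟨y 0 / x 0, sub_eq_zero.1 (eq_zero_of_lorentzForm_self_eq_zero ?_ ?_)⟩
  · have hyx := (lorentzForm_comm y x).trans hxy
    simp [hx, hy, hxy, hyx]
  · simp [h0]

/-! ### Tangent subspaces and spherical scribability. -/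

/-- A subspace that contains a nonzero null vector orthogonal to the whole subspace. -/
def IsNullTangent {d : ℕ} (W : Submodule ℝ (EuclideanSpace ℝ (Fin (d + 1)))) : Prop :=
  ∃ t ∈ W, t ≠ 0 ∧ ∀ y ∈ W, lorentzForm d t y = 0

/-- The faces of `P` can be represented by linear subspaces of Lorentzian space, with all
subspaces of dimension `k + 1` tangent to the light cone. -/
def HasTangentRealization {d : ℕ} (k : ℕ) (P : Set (EuclideanSpace ℝ (Fin d))) : Prop :=
  ∃ W : FaceLattice P → Submodule ℝ (EuclideanSpace ℝ (Fin (d + 1))),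
    (∀ F G, W F ≤ W G ↔ F ≤ G) ∧ ∀ F, Module.finrank ℝ (W F) = k + 1 → IsNullTangent (W F)

theorem exists_mem_lightSphere_smul {d : ℕ} {x : EuclideanSpace ℝ (Fin (d + 1))}
    (hx : lorentzForm d x x = 0) (hx0 : x ≠ 0) : ∃ c : ℝ, c ≠ 0 ∧ c • x ∈ lightSphere d := by
  have hn : ‖x‖ ≠ 0 := norm_ne_zero_iff.2 hx0
  have hp : 0 < ‖x‖⁻¹ := inv_pos.2 (norm_pos_iff.2 hx0)
  have key : ∀ c : ℝ, |c| = ‖x‖⁻¹ → 0 ≤ c * x 0 → c • x ∈ lightSphere d := by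
    intro c hc h
    refine ⟨?_, ?_, ?_⟩
    · rw [mem_sphere_zero_iff_norm, norm_smul, Real.norm_eq_abs, hc, inv_mul_cancel₀ hn]
    · rw [← lorentzForm_apply]; simp [hx]
    · simpa using h
  rcases le_total 0 (x 0) with h | h
  · exact ⟨_, hp.ne', key _ (abs_of_pos hp) (mul_nonneg hp.le h)⟩
  · exact ⟨-‖x‖⁻¹, by simpa using hx0, key _ (by rw [abs_neg, abs_of_pos hp])
      (mul_nonneg_of_nonpos_of_nonpos (by linarith) h)⟩

/-- If `y` in the span is not orthogonal to the tangency point `t`, the line through `y` in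
direction `t` meets the light cone in a vector not orthogonal to `t`; scaled to `lightSphere`, it is
a second common point. -/
theorem IsWeaklyTangent.isNullTangent {d : ℕ} {F : Set (EuclideanSpace ℝ (Fin (d + 1)))}
    (hF : IsWeaklyTangent F) : IsNullTangent (Submodule.span ℝ F) := by
  obtain ⟨t, ht⟩ := hF
  have htm : t ∈ (Submodule.span ℝ F : Set _) ∩ lightSphere d := ht ▸ Set.mem_singleton t
  obtain ⟨htF, hts, htt, -⟩ := htm
  rw [← lorentzForm_apply] at htt
  refine ⟨t, htF, fun h => ?_, fun y hy => ?_⟩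
  · simp [h] at hts
  by_contra hty
  set s : ℝ := -lorentzForm d y y / (2 * lorentzForm d t y) with hs
  have hzF : y + s • t ∈ Submodule.span ℝ F := add_mem hy (Submodule.smul_mem _ _ htF)
  have htz : lorentzForm d t (y + s • t) ≠ 0 := by simpa [htt] using hty
  have hzz : lorentzForm d (y + s • t) (y + s • t) = 0 := by
    have := lorentzForm_comm y t
    simp only [map_add, map_smul, LinearMap.add_apply, LinearMap.smul_apply, smul_eq_mul, this,
      htt, hs]
    field_simp
    ring
  obtain ⟨c, hc, hcz⟩ := exists_mem_lightSphere_smul hzz (fun h => htz (by rw [h, map_zero]))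
  have : c • (y + s • t) = t := by
    have : c • (y + s • t) ∈ (Submodule.span ℝ F : Set _) ∩ lightSphere d :=
      ⟨Submodule.smul_mem _ _ hzF, hcz⟩
    rwa [ht] at this
  have h2 : lorentzForm d t (c • (y + s • t)) = 0 := by rw [this, htt]
  rw [map_smul, smul_eq_mul] at h2
  exact (mul_ne_zero hc htz) h2

theorem IsWeaklyScribable.hasTangentRealization {d k : ℕ} {P : Set (EuclideanSpace ℝ (Fin d))}
    (h : IsWeaklyScribable k P) : HasTangentRealization k P := by
  obtain ⟨Q, -, ⟨e⟩, hQ⟩ := h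
  refine ⟨fun F => Submodule.span ℝ (e F).1, fun F G => ?_,
    fun F hF => (hQ _ ⟨(e F).2, hF⟩).isNullTangent⟩
  rw [← e.le_iff_le]
  refine ⟨fun hFG x hx => ?_, fun hFG => Submodule.span_mono hFG⟩
  obtain ⟨φ, -, hφ⟩ := (e G).2
  obtain ⟨ψ, -, hψ⟩ := (e F).2
  have hxQ : x ∈ Q := by rw [hψ] at hx; exact hx.1
  -- The functional that cuts out a face also vanishes on its span, so the span determines which
  -- points of `Q` belong to the face.
  have hle : Submodule.span ℝ (e G).1 ≤ LinearMap.ker φ := by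
    rw [Submodule.span_le, hφ]
    exact fun y hy => hy.2
  rw [hφ]
  exact ⟨hxQ, hle (hFG (Submodule.subset_span hx))⟩

/-! ### Euclidean spheres and the light cone. -/

/-- The embedding of Euclidean space into Lorentzian space that maps the sphere with center `c`
and radius `r` to the light cone. -/
noncomputable def lorentzLift {d : ℕ} (c : EuclideanSpace ℝ (Fin d)) (r : ℝ)
    (x : EuclideanSpace ℝ (Fin d)) : EuclideanSpace ℝ (Fin (d + 1)) :=
  WithLp.toLp 2 (Fin.cons r fun i => x i - c i)

/-- The linear part of `lorentzLift`. -/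
noncomputable def spatialLift (d : ℕ) :
    EuclideanSpace ℝ (Fin d) →ₗ[ℝ] EuclideanSpace ℝ (Fin (d + 1)) where
  toFun x := WithLp.toLp 2 (Fin.cons 0 fun i => x i)
  map_add' x y := by ext i; refine Fin.cases ?_ (fun j => ?_) i <;> simp
  map_smul' c x := by ext i; refine Fin.cases ?_ (fun j => ?_) i <;> simp

section lift

variable {d : ℕ} (c : EuclideanSpace ℝ (Fin d)) (r : ℝ)

@[simp] theorem lorentzLift_zero (x : EuclideanSpace ℝ (Fin d)) : lorentzLift c r x 0 = r := rfl

@[simp] theorem lorentzLift_succ (x : EuclideanSpace ℝ (Fin d)) (i : Fin d) :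
    lorentzLift c r x i.succ = x i - c i := rfl

@[simp] theorem spatialLift_zero (x : EuclideanSpace ℝ (Fin d)) : spatialLift d x 0 = 0 := rfl

@[simp] theorem spatialLift_succ (x : EuclideanSpace ℝ (Fin d)) (i : Fin d) :
    spatialLift d x i.succ = x i := rfl

theorem spatialLift_injective : Function.Injective (spatialLift d) := by
  intro x y h
  ext i
  exact congrArg (fun z : EuclideanSpace ℝ (Fin (d + 1)) => z i.succ) h

theorem lorentzLift_sub (x y : EuclideanSpace ℝ (Fin d)) :
    lorentzLift c r x - lorentzLift c r y = spatialLift d (x - y) := by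
  ext i
  refine Fin.cases ?_ (fun j => ?_) i <;> simp

theorem lorentzForm_lorentzLift_self (x : EuclideanSpace ℝ (Fin d)) :
    lorentzForm d (lorentzLift c r x) (lorentzLift c r x) = dist x c ^ 2 - r ^ 2 := by
  simp only [lorentzForm_apply, lorentzProd, EuclideanSpace.dist_eq, lorentzLift_zero,
    lorentzLift_succ, Real.dist_eq, sq_abs]
  rw [Real.sq_sqrt (Finset.sum_nonneg fun i _ => sq_nonneg _)]
  simp only [pow_two]
  ring

theorem exists_linearMap_lorentzLift (hr : r ≠ 0) (l : EuclideanSpace ℝ (Fin d) →ₗ[ℝ] ℝ) (m : ℝ) :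
    ∃ φ : EuclideanSpace ℝ (Fin (d + 1)) →ₗ[ℝ] ℝ, ∀ x, φ (lorentzLift c r x) = l x - m := by
  let drop : EuclideanSpace ℝ (Fin (d + 1)) →ₗ[ℝ] EuclideanSpace ℝ (Fin d) :=
    { toFun := fun x => WithLp.toLp 2 fun i => x i.succ
      map_add' := fun x y => by ext i; simp
      map_smul' := fun a x => by ext i; simp }
  let time : EuclideanSpace ℝ (Fin (d + 1)) →ₗ[ℝ] ℝ :=
    { toFun := fun x => x 0
      map_add' := fun x y => by simp
      map_smul' := fun a x => by simp }
  refine ⟨l ∘ₗ drop + ((l c - m) / r) • time, fun x => ?_⟩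
  have h1 : drop (lorentzLift c r x) = x - c := by ext i; simp [drop]
  have h2 : time (lorentzLift c r x) = r := rfl
  simp only [LinearMap.add_apply, LinearMap.comp_apply, LinearMap.smul_apply, h1, h2, map_sub,
    smul_eq_mul]
  field_simp
  ring

theorem map_spatialLift_vectorSpan_le (F : Set (EuclideanSpace ℝ (Fin d))) :
    (vectorSpan ℝ F).map (spatialLift d) ≤ Submodule.span ℝ (lorentzLift c r '' F) := by
  rw [vectorSpan_def, Submodule.map_span, Submodule.span_le]
  rintro _ ⟨_, ⟨x, hx, y, hy, rfl⟩, rfl⟩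
  change spatialLift d (x - y) ∈ _
  rw [← lorentzLift_sub c r]
  exact sub_mem (Submodule.subset_span ⟨x, hx, rfl⟩) (Submodule.subset_span ⟨y, hy, rfl⟩)

theorem finrank_span_lorentzLift (hr : r ≠ 0) {F : Set (EuclideanSpace ℝ (Fin d))}
    (hF : F.Nonempty) :
    Module.finrank ℝ (Submodule.span ℝ (lorentzLift c r '' F)) =
      Module.finrank ℝ (vectorSpan ℝ F) + 1 := by
  obtain ⟨p, hp⟩ := hF
  have h0 : lorentzLift c r p ≠ 0 := fun h => hr (by
    have := congrArg (fun z : EuclideanSpace ℝ (Fin (d + 1)) => z 0) h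
    simpa using this)
  have hsp : Submodule.span ℝ (lorentzLift c r '' F) =
      (vectorSpan ℝ F).map (spatialLift d) ⊔ Submodule.span ℝ {lorentzLift c r p} := by
    apply le_antisymm
    · rw [Submodule.span_le]
      rintro _ ⟨x, hx, rfl⟩
      rw [← sub_add_cancel (lorentzLift c r x) (lorentzLift c r p), lorentzLift_sub]
      exact add_mem
        (Submodule.mem_sup_left (Submodule.mem_map_of_mem (vsub_mem_vectorSpan ℝ hx hp)))
        (Submodule.mem_sup_right (Submodule.mem_span_singleton_self _))
    · refine sup_le (map_spatialLift_vectorSpan_le c r F) ?_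
      · rw [Submodule.span_singleton_le_iff_mem]
        exact Submodule.subset_span ⟨p, hp, rfl⟩
  have hdisj : (vectorSpan ℝ F).map (spatialLift d) ⊓ Submodule.span ℝ {lorentzLift c r p} = ⊥ := by
    rw [eq_bot_iff]
    rintro _ ⟨⟨v, -, rfl⟩, hv⟩
    obtain ⟨a, ha⟩ := Submodule.mem_span_singleton.1 hv
    have := congrArg (fun z : EuclideanSpace ℝ (Fin (d + 1)) => z 0) ha
    simp only [PiLp.smul_apply, lorentzLift_zero, spatialLift_zero, smul_eq_mul, mul_eq_zero, hr,
      or_false] at this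
    rw [← ha, this, zero_smul]
    exact Submodule.zero_mem _
  have := Submodule.finrank_sup_add_finrank_inf_eq ((vectorSpan ℝ F).map (spatialLift d))
    (Submodule.span ℝ {lorentzLift c r p})
  rw [hdisj, finrank_bot, add_zero, finrank_span_singleton h0,
    LinearEquiv.finrank_eq (Submodule.equivMapOfInjective (spatialLift d) spatialLift_injective
      (vectorSpan ℝ F)).symm] at this
  rw [hsp, this]

/-- As in the spherical case, a vector not orthogonal to the lift of `t` produces a second null
direction. It must also be scaled back to height `r` to give a point of the affine hull. -/
theorem isNullTangent_of_affineSpan_inter_sphere (hr : 0 < r)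
    {F : Set (EuclideanSpace ℝ (Fin d))} {t : EuclideanSpace ℝ (Fin d)} (hF : F.Nonempty)
    (ht : (affineSpan ℝ F : Set (EuclideanSpace ℝ (Fin d))) ∩ Metric.sphere c r = {t}) :
    IsNullTangent (Submodule.span ℝ (lorentzLift c r '' F)) := by
  have htm : t ∈ (affineSpan ℝ F : Set _) ∩ Metric.sphere c r := ht ▸ Set.mem_singleton t
  obtain ⟨htF, hts⟩ := htm
  have htt : lorentzForm d (lorentzLift c r t) (lorentzLift c r t) = 0 := by
    rw [lorentzForm_lorentzLift_self, Metric.mem_sphere.1 hts, sub_self]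
  have htW : lorentzLift c r t ∈ Submodule.span ℝ (lorentzLift c r '' F) := by
    obtain ⟨p, hp⟩ := hF
    rw [← sub_add_cancel (lorentzLift c r t) (lorentzLift c r p), lorentzLift_sub]
    refine add_mem ?_ (Submodule.subset_span ⟨p, hp, rfl⟩)
    have h1 : t - p ∈ vectorSpan ℝ F := by
      rw [← direction_affineSpan]
      exact AffineSubspace.vsub_mem_direction htF (subset_affineSpan ℝ F hp)
    exact map_spatialLift_vectorSpan_le c r F (Submodule.mem_map_of_mem h1)
  refine ⟨_, htW, fun h => hr.ne' ?_, fun y hy => ?_⟩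
  · have := congrArg (fun z : EuclideanSpace ℝ (Fin (d + 1)) => z 0) h
    simpa using this
  suffices h : Submodule.span ℝ (lorentzLift c r '' F) ≤
      LinearMap.ker (lorentzForm d (lorentzLift c r t)) from h hy
  rw [Submodule.span_le]
  rintro _ ⟨x, hx, rfl⟩
  rw [SetLike.mem_coe, LinearMap.mem_ker]
  by_contra htx
  set s : ℝ := -lorentzForm d (lorentzLift c r x) (lorentzLift c r x) /
    (2 * lorentzForm d (lorentzLift c r t) (lorentzLift c r x)) with hs
  have htz : lorentzForm d (lorentzLift c r t) (lorentzLift c r x + s • lorentzLift c r t) ≠ 0 := by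
    simpa [htt] using htx
  have hzz : lorentzForm d (lorentzLift c r x + s • lorentzLift c r t)
      (lorentzLift c r x + s • lorentzLift c r t) = 0 := by
    have := lorentzForm_comm (lorentzLift c r x) (lorentzLift c r t)
    simp only [map_add, map_smul, LinearMap.add_apply, LinearMap.smul_apply, smul_eq_mul, this,
      htt]
    rw [hs]
    field_simp
    ring
  -- The new null vector has height `(1 + s) * r`; at height zero it would be zero.
  have h1s : 1 + s ≠ 0 := by
    intro h
    refine htz ?_
    rw [eq_zero_of_lorentzForm_self_eq_zero hzz, map_zero]
    simp only [PiLp.add_apply, PiLp.smul_apply, lorentzLift_zero, smul_eq_mul]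
    linear_combination r * h
  have hlift : lorentzLift c r (AffineMap.lineMap t x (1 + s)⁻¹) =
      (1 + s)⁻¹ • (lorentzLift c r x + s • lorentzLift c r t) := by
    ext i
    refine Fin.cases ?_ (fun j => ?_) i
    · simp
      field_simp
    · simp [AffineMap.lineMap_apply]
      field_simp
      ring
  have hmem : AffineMap.lineMap t x (1 + s)⁻¹ ∈
      (affineSpan ℝ F : Set _) ∩ Metric.sphere c r := by
    refine ⟨AffineMap.lineMap_mem _ htF (subset_affineSpan ℝ F hx), ?_⟩
    have h := lorentzForm_lorentzLift_self c r (AffineMap.lineMap t x (1 + s)⁻¹)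
    rw [hlift, map_smul, map_smul, LinearMap.smul_apply, hzz, smul_zero, smul_zero] at h
    rw [Metric.mem_sphere]
    exact (pow_left_inj₀ dist_nonneg hr.le two_ne_zero).1 (by linarith)
  rw [ht, Set.mem_singleton_iff] at hmem
  rw [hmem] at hlift
  have h := congrArg (lorentzForm d (lorentzLift c r t)) hlift
  rw [htt, map_smul, smul_eq_mul] at h
  exact mul_ne_zero (inv_ne_zero h1s) htz h.symm

end lift

theorem IsEuclideanWeaklyScribable.hasTangentRealization {d k : ℕ}
    {P : Set (EuclideanSpace ℝ (Fin d))} (h : IsEuclideanWeaklyScribable k P) :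
    HasTangentRealization k P := by
  obtain ⟨Q, -, ⟨e⟩, c, r, hr, hQ⟩ := h
  refine ⟨fun F => Submodule.span ℝ (lorentzLift c r '' (e F).1), fun F G => ?_, fun F hF => ?_⟩
  · rw [← e.le_iff_le]
    refine ⟨fun hFG x hx => ?_, fun hFG => Submodule.span_mono (Set.image_mono hFG)⟩
    have hx' : lorentzLift c r x ∈ Submodule.span ℝ (lorentzLift c r '' (e G).1) :=
      hFG (Submodule.subset_span ⟨x, hx, rfl⟩)
    have hG : (e G).1.Nonempty := by
      by_contra hG
      rw [Set.not_nonempty_iff_eq_empty] at hG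
      rw [hG, Set.image_empty, Submodule.span_empty, Submodule.mem_bot] at hx'
      have := congrArg (fun z : EuclideanSpace ℝ (Fin (d + 1)) => z 0) hx'
      exact hr.ne' (by simpa using this)
    have hxQ : x ∈ Q := (e F).2.subset hx
    obtain ⟨l, hl⟩ := (e G).2 hG
    obtain ⟨y, hy⟩ := hG
    obtain ⟨φ, hφ⟩ := exists_linearMap_lorentzLift c r hr.ne' (l : _ →ₗ[ℝ] ℝ) (l y)
    have hle : Submodule.span ℝ (lorentzLift c r '' (e G).1) ≤ LinearMap.ker φ := by
      rw [Submodule.span_le]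
      rintro _ ⟨z, hz, rfl⟩
      rw [hl] at hy hz
      rw [SetLike.mem_coe, LinearMap.mem_ker, hφ]
      exact sub_eq_zero.2 (le_antisymm (hy.2 z hz.1) (hz.2 y hy.1))
    have hxy : l x = l y := by
      have := hle hx'
      rw [LinearMap.mem_ker, hφ] at this
      exact sub_eq_zero.1 this
    rw [hl] at hy ⊢
    exact ⟨hxQ, fun z hz => hxy ▸ hy.2 z hz⟩
  · have hne : (e F).1.Nonempty := by
      by_contra hne
      rw [Set.not_nonempty_iff_eq_empty] at hne
      beta_reduce at hF
      rw [hne, Set.image_empty, Submodule.span_empty, finrank_bot] at hF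
      omega
    rw [finrank_span_lorentzLift c r hr.ne' hne] at hF
    obtain ⟨t, ht⟩ := hQ _ ⟨(e F).2, hne, by omega⟩
    exact isNullTangent_of_affineSpan_inter_sphere c r hr hne ht

/-! ### Faces as minima of functionals. -/

section faces

variable {d : ℕ} {ι κ : Type*}

/-- The points of the convex hull of `p` at which the functionals `l j`, `j ∈ J`, have the
values `c j`. -/
def hullFace (p : ι → EuclideanSpace ℝ (Fin d)) (l : κ → EuclideanSpace ℝ (Fin d) →ₗ[ℝ] ℝ)
    (c : κ → ℝ) (J : Finset κ) : Set (EuclideanSpace ℝ (Fin d)) :=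
  {x | x ∈ convexHull ℝ (Set.range p) ∧ ∀ j ∈ J, l j x = c j}

variable {p : ι → EuclideanSpace ℝ (Fin d)} {l : κ → EuclideanSpace ℝ (Fin d) →ₗ[ℝ] ℝ} {c : κ → ℝ}

theorem le_of_mem_convexHull (h : ∀ i j, c j ≤ l j (p i)) {x : EuclideanSpace ℝ (Fin d)}
    (hx : x ∈ convexHull ℝ (Set.range p)) (j : κ) : c j ≤ l j x := by
  have hconv : Convex ℝ {y | c j ≤ l j y} := convex_halfSpace_ge (l j).isLinear _
  refine convexHull_min ?_ hconv hx
  rintro _ ⟨i, rfl⟩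
  exact h i j

theorem isExposed_hullFace (h : ∀ i j, c j ≤ l j (p i)) (J : Finset κ) :
    IsExposed ℝ (convexHull ℝ (Set.range p)) (hullFace p l c J) := by
  rintro ⟨y, hy, hyJ⟩
  refine ⟨LinearMap.toContinuousLinearMap (-∑ j ∈ J, l j), ?_⟩
  ext x
  simp only [hullFace, Set.mem_ofPred_eq, LinearMap.coe_toContinuousLinearMap', LinearMap.neg_apply,
    LinearMap.sum_apply, neg_le_neg_iff]
  refine and_congr_right fun hx => ⟨fun hxJ z hz => ?_, fun hmax j hj => ?_⟩
  · exact Finset.sum_le_sum fun j hj => (hxJ j hj).trans_le (le_of_mem_convexHull h hz j)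
  · have h1 := (hmax y hy).trans_eq (Finset.sum_congr rfl hyJ)
    have h2 : ∑ j ∈ J, c j ≤ ∑ j ∈ J, l j x :=
      Finset.sum_le_sum fun j _ => le_of_mem_convexHull h hx j
    have h3 := (Finset.sum_eq_sum_iff_of_le
      fun j (_ : j ∈ J) => le_of_mem_convexHull h hx j).1 (le_antisymm h2 h1)
    exact (h3 j hj).symm

/-- In a convex combination that minimizes a functional, every point of positive weight minimizes it
too. Inclusion of faces can therefore be tested on the points `p i`. -/
theorem hullFace_subset_iff (h : ∀ i j, c j ≤ l j (p i)) (J J' : Finset κ) :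
    hullFace p l c J ⊆ hullFace p l c J' ↔
      ∀ i, (∀ j ∈ J, l j (p i) = c j) → ∀ j ∈ J', l j (p i) = c j := by
  refine ⟨fun hJ i hi => (hJ ⟨subset_convexHull ℝ _ ⟨i, rfl⟩, hi⟩).2, ?_⟩
  rintro hJ x ⟨hx, hxJ⟩
  refine ⟨hx, ?_⟩
  obtain ⟨τ, _, w, z, hw, hw1, hz, rfl⟩ := mem_convexHull_iff_exists_fintype.1 hx
  have hval : ∀ j, l j (∑ i, w i • z i) - c j = ∑ i, w i * (l j (z i) - c j) := by
    intro j
    simp only [map_sum, map_smul, smul_eq_mul, mul_sub, Finset.sum_sub_distrib, ← Finset.sum_mul,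
      hw1, one_mul]
  have hnn : ∀ j i, 0 ≤ w i * (l j (z i) - c j) := by
    intro j i
    obtain ⟨s, hs⟩ := hz i
    exact mul_nonneg (hw i) (sub_nonneg.2 (hs ▸ h s j))
  intro j' hj'
  rw [← sub_eq_zero, hval]
  refine Finset.sum_eq_zero fun i _ => ?_
  rcases eq_or_ne (w i) 0 with h0 | h0
  · rw [h0, zero_mul]
  obtain ⟨s, hs⟩ := hz i
  rw [← hs, hJ s ?_ j' hj', sub_self, mul_zero]
  intro j hj
  have h1 := hval j
  rw [hxJ j hj, sub_self] at h1
  have h2 := (Finset.sum_eq_zero_iff_of_nonneg fun i _ => hnn j i).1 h1.symm i (Finset.mem_univ i)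
  rw [hs]
  exact sub_eq_zero.1 ((mul_eq_zero.1 h2).resolve_left h0)

end faces

theorem affineSpan_eq_top_of_zero_mem_of_single_mem {d : ℕ} {P : Set (EuclideanSpace ℝ (Fin d))}
    (h0 : 0 ∈ affineSpan ℝ P) (h1 : ∀ s, EuclideanSpace.single s (1 : ℝ) ∈ affineSpan ℝ P) :
    affineSpan ℝ P = ⊤ := by
  rw [← AffineSubspace.direction_eq_top_iff_of_nonempty ⟨0, h0⟩, eq_top_iff,
    ← (EuclideanSpace.basisFun (Fin d) ℝ).toBasis.span_eq, Submodule.span_le]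
  rintro _ ⟨s, rfl⟩
  have := AffineSubspace.vsub_mem_direction (h1 s) h0
  simpa using this

/-! ### Joins with a simplex. -/

section join

variable {m l : ℕ} (n : ℕ)

/-- The vertices of the join of the convex hull of the points `q i` in `ℝ³` with a simplex with
`n` vertices. -/
noncomputable def joinPoint (q : Fin m → Fin 3 → ℝ) :
    Fin m ⊕ Fin n → EuclideanSpace ℝ (Fin (3 + n)) :=
  Sum.elim (fun i => WithLp.toLp 2 (Fin.append (q i) 0))
    (fun t => EuclideanSpace.single (Fin.natAdd 3 t) 1)

/-- The functionals on `ℝ^{3+n}` that extend the affine functionals `a j · x + b j` on `ℝ³`,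
together with the last `n` coordinates. -/
noncomputable def joinFunctional (a : Fin l → Fin 3 → ℝ) (b : Fin l → ℝ) :
    Fin l ⊕ Fin n → EuclideanSpace ℝ (Fin (3 + n)) →ₗ[ℝ] ℝ :=
  Sum.elim (fun j => ∑ s, a j s • EuclideanSpace.projₗ (Fin.castAdd n s) -
      b j • ∑ t, EuclideanSpace.projₗ (Fin.natAdd 3 t))
    (fun t => EuclideanSpace.projₗ (Fin.natAdd 3 t))

/-- The minima of the functionals `joinFunctional` on the join. -/
def joinConst (b : Fin l → ℝ) : Fin l ⊕ Fin n → ℝ := Sum.elim (fun j => -b j) 0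

variable (q : Fin m → Fin 3 → ℝ) (a : Fin l → Fin 3 → ℝ) (b : Fin l → ℝ)

theorem joinFunctional_inl_inl (i : Fin m) (j : Fin l) :
    joinFunctional n a b (Sum.inl j) (joinPoint n q (Sum.inl i)) = ∑ s, a j s * q i s := by
  simp [joinFunctional, joinPoint]

/-- The term in `b j` serves this purpose: each functional coming from the first factor is minimal
at all vertices of the simplex. -/
theorem joinFunctional_inl_inr (t : Fin n) (j : Fin l) :
    joinFunctional n a b (Sum.inl j) (joinPoint n q (Sum.inr t)) = -b j := by
  have : ∀ s : Fin 3, Fin.castAdd n s ≠ Fin.natAdd 3 t := by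
    intro s h
    have := congrArg Fin.val h
    simp at this
    omega
  simp [joinFunctional, joinPoint, this]

theorem joinFunctional_inr_inl (i : Fin m) (t : Fin n) :
    joinFunctional n a b (Sum.inr t) (joinPoint n q (Sum.inl i)) = 0 := by
  simp [joinFunctional, joinPoint]

theorem joinFunctional_inr_inr (t t' : Fin n) :
    joinFunctional n a b (Sum.inr t) (joinPoint n q (Sum.inr t')) = if t = t' then 1 else 0 := by
  simp [joinFunctional, joinPoint]

variable {q a b}

theorem joinConst_le_joinFunctional (h : ∀ i j, 0 ≤ ∑ s, a j s * q i s + b j) (i j) :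
    joinConst n b j ≤ joinFunctional n a b j (joinPoint n q i) := by
  rcases i with i | t <;> rcases j with j | t'
  · rw [joinFunctional_inl_inl]
    have := h i j
    simp only [joinConst, Sum.elim_inl]
    linarith
  · rw [joinFunctional_inr_inl]; rfl
  · rw [joinFunctional_inl_inr]; rfl
  · rw [joinFunctional_inr_inr]
    simp only [joinConst, Sum.elim_inr, Pi.zero_apply]
    split_ifs <;> norm_num

theorem isPolytope_join (h0 : ∃ i i', q i + q i' = 0)
    (h1 : ∀ s : Fin 3, ∃ i, q i = Pi.single s 1) :
    IsPolytope (convexHull ℝ (Set.range (joinPoint n q))) := by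
  refine ⟨⟨_, Set.finite_range _, rfl⟩, ?_⟩
  have hp : ∀ i, joinPoint n q i ∈ affineSpan ℝ (convexHull ℝ (Set.range (joinPoint n q))) :=
    fun i => subset_affineSpan ℝ _ (subset_convexHull ℝ _ ⟨i, rfl⟩)
  refine affineSpan_eq_top_of_zero_mem_of_single_mem ?_ fun s => ?_
  · obtain ⟨i, i', hi⟩ := h0
    convert AffineMap.lineMap_mem (2⁻¹ : ℝ) (hp (Sum.inl i)) (hp (Sum.inl i')) using 1
    have hi' : ∀ s, q i' s = -q i s := fun s => by
      have := congrFun hi s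
      simp only [Pi.add_apply, Pi.zero_apply] at this
      linarith
    ext s
    refine Fin.addCases (fun s => ?_) (fun t => ?_) s
    · simp [joinPoint, AffineMap.lineMap_apply, hi']
      ring
    · simp [joinPoint, AffineMap.lineMap_apply]
  · refine Fin.addCases (fun s => ?_) (fun t => hp (Sum.inr t)) s
    obtain ⟨i, hi⟩ := h1 s
    convert hp (Sum.inl i) using 1
    ext s'
    refine Fin.addCases (fun s' => ?_) (fun t => ?_) s'
    · simp [joinPoint, hi, Pi.single_apply]
    · have : Fin.natAdd 3 t ≠ Fin.castAdd n s := by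
        intro h
        have := congrArg Fin.val h
        simp at this
        omega
      simp [joinPoint, this]

/-- Faces of the join: a face of the first factor, cut out by the functionals in `J`, joined with
a face `T` of the simplex. -/
theorem exists_faces_join (h : ∀ i j, 0 ≤ ∑ s, a j s * q i s + b j) :
    ∃ F : Finset (Fin l) → Finset (Fin n) →
        FaceLattice (convexHull ℝ (Set.range (joinPoint n q))),
      ∀ J T J' T', F J T ≤ F J' T' ↔
        (∀ i, (∀ j ∈ J, ∑ s, a j s * q i s + b j = 0) →
          ∀ j ∈ J', ∑ s, a j s * q i s + b j = 0) ∧ T ⊆ T' := by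
  have hle := joinConst_le_joinFunctional n h
  -- The coordinates in `Tᶜ` are required to vanish, which removes exactly the simplex vertices
  -- outside `T`.
  refine ⟨fun J T => ⟨_, isExposed_hullFace hle (J.disjSum Tᶜ)⟩, fun J T J' T' => ?_⟩
  rw [Subtype.mk_le_mk, hullFace_subset_iff hle]
  have key : ∀ (J : Finset (Fin l)) (T : Finset (Fin n)) (i : Fin m ⊕ Fin n),
      (∀ j ∈ J.disjSum Tᶜ, joinFunctional n a b j (joinPoint n q i) = joinConst n b j) ↔
        Sum.elim (fun i => ∀ j ∈ J, ∑ s, a j s * q i s + b j = 0) (fun t => t ∈ T) i := by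
    intro J T i
    rcases i with i | t
    · simp [joinFunctional_inl_inl, joinFunctional_inr_inl, joinConst, eq_neg_iff_add_eq_zero]
    · simp only [Finset.mem_disjSum, joinConst, Sum.elim_inr]
      constructor
      · intro ht
        by_contra htT
        have := ht (Sum.inr t) (Or.inr ⟨t, by simpa using htT, rfl⟩)
        simp [joinFunctional_inr_inr] at this
      · rintro ht _ (⟨j, -, rfl⟩ | ⟨t', ht', rfl⟩)
        · simp [joinFunctional_inl_inr]
        · have : t' ≠ t := by rintro rfl; simp [ht] at ht'
          simp [joinFunctional_inr_inr, this]
  simp only [key, Sum.forall, Sum.elim_inl, Sum.elim_inr, Finset.subset_iff]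

end join

/-! ### A cube with a corner cut off -/

/-- The vertices on the facets of the polytope `C` obtained from the cube `[0, 1]³` by moving
the vertex `(1, 1, 1)` to `(1, 1, 1 / 2)` and taking the convex hull. The vertices are `0`, the
three unit vectors, `(0, 1, 1)`, `(1, 0, 1)`, `(1, 1, 0)` and `(1, 1, 1 / 2)`, in this order. -/
def facetVerts : Fin 7 → Finset (Fin 8) :=
  ![{0, 2, 3, 4}, {0, 1, 3, 5}, {0, 1, 2, 6}, {1, 5, 6, 7}, {2, 4, 6, 7}, {3, 4, 5}, {4, 5, 7}]

/-- The vertices on six of the edges of `C`, which suffice for the flags that we need. -/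
def edgeVerts : Fin 6 → Finset (Fin 8) :=
  ![{0, 1}, {3, 4}, {6, 7}, {2, 6}, {1, 5}, {4, 5}]

/-- The faces of `C` without some of the edges. -/
inductive CutFace where
  | bot : CutFace
  | vertex : Fin 8 → CutFace
  | edge : Fin 6 → CutFace
  | facet : Fin 7 → CutFace
  | top : CutFace

namespace CutFace

/-- The vertices of a face of `C`. -/
def verts : CutFace → Finset (Fin 8)
  | bot => ∅
  | vertex i => {i}
  | edge e => edgeVerts e
  | facet j => facetVerts j
  | top => Finset.univ

/-- The facets that contain a face of `C`. -/
def facets (a : CutFace) : Finset (Fin 7) := {j | a.verts ⊆ facetVerts j}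

/-- The rank of a face of `C` in the face lattice. -/
def rank : CutFace → ℕ
  | bot => 0
  | vertex _ => 1
  | edge _ => 2
  | facet _ => 3
  | top => 4

/-- Each listed face is the intersection of the facets containing it, so faces can be encoded by
sets of facets. -/
theorem mem_verts_iff (a : CutFace) (i : Fin 8) :
    i ∈ a.verts ↔ ∀ j ∈ a.facets, i ∈ facetVerts j := by
  cases a <;> decide +revert

theorem mem_facets_iff (a : CutFace) (j : Fin 7) :
    j ∈ a.facets ↔ ∀ i ∈ a.verts, i ∈ facetVerts j := by
  simp [facets, Finset.subset_iff]

theorem rank_le (a : CutFace) : a.rank ≤ 4 := by cases a <;> simp [rank]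

theorem exists_covering (a : CutFace) (ha : a.rank < 4) :
    ∃ b : CutFace, a.verts ⊂ b.verts ∧ b.rank = a.rank + 1 := by
  rcases a with _ | i | e | j | _
  · exact ⟨vertex 0, by decide, rfl⟩
  · obtain ⟨e, he⟩ : ∃ e, verts (vertex i) ⊂ verts (edge e) := by decide +revert
    exact ⟨edge e, he, rfl⟩
  · obtain ⟨j, hj⟩ : ∃ j, verts (edge e) ⊂ verts (facet j) := by clear ha; decide +revert
    exact ⟨facet j, hj, rfl⟩
  · exact ⟨top, by clear ha; decide +revert, rfl⟩
  · simp [rank] at ha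

theorem exists_covered (a : CutFace) (ha : 0 < a.rank) :
    ∃ b : CutFace, b.verts ⊂ a.verts ∧ b.rank + 1 = a.rank := by
  rcases a with _ | i | e | j | _
  · simp [rank] at ha
  · exact ⟨bot, by clear ha; decide +revert, rfl⟩
  · obtain ⟨i, hi⟩ : ∃ i, verts (vertex i) ⊂ verts (edge e) := by clear ha; decide +revert
    exact ⟨vertex i, hi, rfl⟩
  · obtain ⟨e, he⟩ : ∃ e, verts (edge e) ⊂ verts (facet j) := by clear ha; decide +revert
    exact ⟨edge e, he, rfl⟩
  · exact ⟨facet 0, by decide, rfl⟩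

end CutFace

/-! ### Dimensions forced by flags. -/

/-- A strictly monotone function that is bounded by the length of the maximal chains of a graded
order is the rank function. -/
theorem eq_rank_of_strictMono {β : Type*} (lt : β → β → Prop) (r f : β → ℕ) (N : ℕ)
    (hf : ∀ a b, lt a b → f a < f b) (hfN : ∀ a, f a ≤ N) (hrN : ∀ a, r a ≤ N)
    (hup : ∀ a, r a < N → ∃ b, lt a b ∧ r b = r a + 1)
    (hdown : ∀ a, 0 < r a → ∃ b, lt b a ∧ r b + 1 = r a) (a : β) : f a = r a := by
  -- Descending from `a` to rank zero bounds `f a` below; ascending to rank `N` bounds it above.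
  have hge : ∀ s a, r a = s → s ≤ f a := by
    intro s
    induction s with
    | zero => intro a _; exact Nat.zero_le _
    | succ s ih =>
      intro a ha
      obtain ⟨b, hb, hr⟩ := hdown a (by omega)
      have := ih b (by omega)
      have := hf _ _ hb
      omega
  have hle : ∀ s a, r a + s = N → f a + s ≤ N := by
    intro s
    induction s with
    | zero => intro a _; exact hfN a
    | succ s ih =>
      intro a ha
      obtain ⟨b, hb, hr⟩ := hup a (by omega)
      have := ih b (by omega)
      have := hf _ _ hb
      omega
  have h1 := hge (r a) a rfl
  have h2 := hle (N - r a) a (by have := hrN a; omega)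
  have := hrN a
  omega

section rank

variable {n : ℕ} {E : Type*} [AddCommGroup E] [Module ℝ E] [FiniteDimensional ℝ E]
  {W : CutFace → Finset (Fin n) → Submodule ℝ E}

/-- A flag of pairs `(a, T)` has `4 + n` strict steps, as many as the dimension of `E` allows, so
the dimension grows by one at each step. -/
theorem finrank_eq_of_strictMono {lt : CutFace → CutFace → Prop} {r : CutFace → ℕ}
    (hr : ∀ a, r a ≤ 4) (hup : ∀ a, r a < 4 → ∃ b, lt a b ∧ r b = r a + 1)
    (hdown : ∀ a, 0 < r a → ∃ b, lt b a ∧ r b + 1 = r a)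
    (hE : Module.finrank ℝ E = 4 + n)
    (hW1 : ∀ a b T, lt a b → W a T < W b T) (hW2 : ∀ a T T', T ⊂ T' → W a T < W a T')
    (a : CutFace) (T : Finset (Fin n)) : Module.finrank ℝ (W a T) = r a + T.card := by
  refine eq_rank_of_strictMono (β := CutFace × Finset (Fin n))
    (fun x y => (lt x.1 y.1 ∧ x.2 = y.2) ∨ (x.1 = y.1 ∧ x.2 ⊂ y.2))
    (fun x => r x.1 + x.2.card) (fun x => Module.finrank ℝ (W x.1 x.2)) (4 + n) ?_ ?_ ?_ ?_ ?_ (a, T)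
  · rintro ⟨a, T⟩ ⟨b, T'⟩ (⟨h, h'⟩ | ⟨h, h'⟩) <;> dsimp only at h h' <;> subst_vars
    · exact Submodule.finrank_lt_finrank_of_lt (hW1 _ _ _ h)
    · exact Submodule.finrank_lt_finrank_of_lt (hW2 _ _ _ h')
  · rintro ⟨a, T⟩
    exact hE ▸ Submodule.finrank_le _
  · rintro ⟨a, T⟩
    have := T.card_le_univ
    rw [Fintype.card_fin] at this
    exact add_le_add (hr a) this
  · rintro ⟨a, T⟩ h
    dsimp only at h
    by_cases ha : r a < 4
    · obtain ⟨b, hb, hrb⟩ := hup a ha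
      exact ⟨(b, T), Or.inl ⟨hb, rfl⟩, by dsimp only; omega⟩
    · have hT : T ≠ Finset.univ := by
        rintro rfl
        rw [Finset.card_univ, Fintype.card_fin] at h
        have := hr a
        omega
      obtain ⟨t, ht⟩ : ∃ t, t ∉ T := by
        by_contra! hall
        exact hT (Finset.eq_univ_iff_forall.2 hall)
      exact ⟨(a, insert t T), Or.inr ⟨rfl, Finset.ssubset_insert ht⟩,
        by dsimp only; rw [Finset.card_insert_of_notMem ht]; omega⟩
  · rintro ⟨a, T⟩ h
    dsimp only at h
    by_cases ha : 0 < r a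
    · obtain ⟨b, hb, hrb⟩ := hdown a ha
      exact ⟨(b, T), Or.inl ⟨hb, rfl⟩, by dsimp only; omega⟩
    · obtain ⟨t, ht⟩ : T.Nonempty := Finset.card_pos.1 (by omega)
      exact ⟨(a, T.erase t), Or.inr ⟨rfl, Finset.erase_ssubset ht⟩,
        by dsimp only; rw [← Finset.card_erase_add_one ht]; omega⟩

theorem finrank_eq_rank_add_card (hE : Module.finrank ℝ E = 4 + n)
    (hW : ∀ a T b T', W a T ≤ W b T' ↔ a.verts ⊆ b.verts ∧ T ⊆ T')
    (a : CutFace) (T : Finset (Fin n)) : Module.finrank ℝ (W a T) = a.rank + T.card := by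
  refine finrank_eq_of_strictMono (lt := fun a b => a.verts ⊂ b.verts) CutFace.rank_le
    CutFace.exists_covering CutFace.exists_covered hE (fun a b T h => ?_) (fun a T T' h => ?_) a T
  · rw [lt_iff_le_not_ge, hW, hW]
    exact ⟨⟨h.1, subset_rfl⟩, fun h' => h.2 h'.1⟩
  · rw [lt_iff_le_not_ge, hW, hW]
    exact ⟨⟨subset_rfl, h.1⟩, fun h' => h.2 h'.2⟩

theorem finrank_eq_corank_add_card (hE : Module.finrank ℝ E = 4 + n)
    (hW : ∀ a T b T', W a T ≤ W b T' ↔ b.verts ⊆ a.verts ∧ T ⊆ T')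
    (a : CutFace) (T : Finset (Fin n)) : Module.finrank ℝ (W a T) = 4 - a.rank + T.card := by
  refine finrank_eq_of_strictMono (lt := fun a b => b.verts ⊂ a.verts) (r := fun a => 4 - a.rank)
    (fun a => Nat.sub_le _ _) (fun a ha => ?_) (fun a ha => ?_) hE (fun a b T h => ?_)
    (fun a T T' h => ?_) a T
  · obtain ⟨b, hb, hr⟩ := a.exists_covered (by omega)
    have := a.rank_le
    exact ⟨b, hb, by omega⟩
  · obtain ⟨b, hb, hr⟩ := a.exists_covering (by omega)
    exact ⟨b, hb, by omega⟩
  · rw [lt_iff_le_not_ge, hW, hW]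
    exact ⟨⟨h.1, subset_rfl⟩, fun h' => h.2 h'.1⟩
  · rw [lt_iff_le_not_ge, hW, hW]
    exact ⟨⟨subset_rfl, h.1⟩, fun h' => h.2 h'.2⟩

end rank

/-! ### The eighth vertex on a quadric. -/

section incidence

variable {E : Type*} [AddCommGroup E] [Module ℝ E]

/-- If the eight vertices of `C` are null vectors, then the last one forces the vertices `0` and
`3` to be orthogonal: a quadric through the first seven is a combination of the three pairs of
opposite facets of the cube. -/
theorem orthogonal_of_incidence (B : LinearMap.BilinForm ℝ E) (hB : ∀ x y, B x y = B y x)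
    (V : Submodule ℝ E) (t : Fin 8 → E) (φ : Fin 7 → E →ₗ[ℝ] ℝ) (htV : ∀ i, t i ∈ V)
    (ht : ∀ i, B (t i) (t i) = 0) (hφ : ∀ i j, φ j (t i) = 0 ↔ i ∈ facetVerts j)
    (hinj : ∀ w ∈ V, φ 0 w = 0 → φ 1 w = 0 → φ 2 w = 0 → φ 3 w = 0 → w = 0) :
    B (t 0) (t 3) = 0 := by
  have z : ∀ i j, i ∈ facetVerts j → φ j (t i) = 0 := fun i j => (hφ i j).2
  have nz : ∀ i j, i ∉ facetVerts j → φ j (t i) ≠ 0 := fun i j => mt (hφ i j).1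
  have expand : ∀ p ∈ V, ∃ a : ℝ, p = a • t 0 + (φ 0 p / φ 0 (t 1)) • t 1 +
      (φ 1 p / φ 1 (t 2)) • t 2 + (φ 2 p / φ 2 (t 3)) • t 3 := by
    intro p hp
    have n1 := nz 1 0 (by decide)
    have n2 := nz 2 1 (by decide)
    have n3 := nz 3 2 (by decide)
    have n0 := nz 0 3 (by decide)
    -- The facets `0`, `1`, `2` meet in `t 0` and fix the other three coefficients; this one makes
    -- `φ 3` agree.
    refine ⟨(φ 3 p - φ 1 p / φ 1 (t 2) * φ 3 (t 2) - φ 2 p / φ 2 (t 3) * φ 3 (t 3)) / φ 3 (t 0),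
      ?_⟩
    rw [← sub_eq_zero]
    refine hinj _ (sub_mem hp (add_mem (add_mem (add_mem (V.smul_mem _ (htV 0))
      (V.smul_mem _ (htV 1))) (V.smul_mem _ (htV 2))) (V.smul_mem _ (htV 3)))) ?_ ?_ ?_ ?_
    · simp [z 0 0 (by decide), z 2 0 (by decide), z 3 0 (by decide), n1]
    · simp [z 0 1 (by decide), z 1 1 (by decide), z 3 1 (by decide), n2]
    · simp [z 0 2 (by decide), z 1 2 (by decide), z 2 2 (by decide), n3]
    · simp [z 1 3 (by decide), n0]
      ring
  have quad : ∀ a b c e : ℝ,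
      B (a • t 0 + b • t 1 + c • t 2 + e • t 3) (a • t 0 + b • t 1 + c • t 2 + e • t 3) =
        2 * (a * b * B (t 0) (t 1) + a * c * B (t 0) (t 2) + a * e * B (t 0) (t 3) +
          b * c * B (t 1) (t 2) + b * e * B (t 1) (t 3) + c * e * B (t 2) (t 3)) := by
    intro a b c e
    simp only [map_add, map_smul, LinearMap.add_apply, LinearMap.smul_apply, smul_eq_mul, ht,
      hB (t 1) (t 0), hB (t 2) (t 0), hB (t 3) (t 0), hB (t 2) (t 1), hB (t 3) (t 1),
      hB (t 3) (t 2)]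
    ring
  -- With `b`, `c`, `e` the coefficients of `p` at `t 1`, `t 2`, `t 3`, the aim is `B p p / 2 = α *
  -- b * φ 3 p + β * c * φ 4 p + γ * e * φ 5 p`. The products with `t 0` determine `α`, `β`, `γ`.
  obtain ⟨α, hα⟩ : ∃ α, B (t 0) (t 1) = α * φ 3 (t 0) :=
    ⟨_, (div_mul_cancel₀ _ (nz 0 3 (by decide))).symm⟩
  obtain ⟨β, hβ⟩ : ∃ β, B (t 0) (t 2) = β * φ 4 (t 0) :=
    ⟨_, (div_mul_cancel₀ _ (nz 0 4 (by decide))).symm⟩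
  obtain ⟨γ, hγ⟩ : ∃ γ, B (t 0) (t 3) = γ * φ 5 (t 0) :=
    ⟨_, (div_mul_cancel₀ _ (nz 0 5 (by decide))).symm⟩
  -- The vertex `6` lies on facets `2`, `3`, `4`; its nullity determines this product. Vertices `5`
  -- and `4` do the same for the other two.
  have h12 : B (t 1) (t 2) = α * φ 3 (t 2) + β * φ 4 (t 1) := by
    obtain ⟨a, ha⟩ := expand (t 6) (htV 6)
    have n1 := div_ne_zero (nz 6 0 (by decide)) (nz 1 0 (by decide))
    have n2 := div_ne_zero (nz 6 1 (by decide)) (nz 2 1 (by decide))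
    rw [z 6 2 (by decide), zero_div] at ha
    set b := φ 0 (t 6) / φ 0 (t 1)
    set c := φ 1 (t 6) / φ 1 (t 2)
    have hq := ht 6
    have h3 := z 6 3 (by decide)
    have h4 := z 6 4 (by decide)
    rw [ha, quad] at hq
    rw [ha] at h3 h4
    simp only [map_add, map_smul, smul_eq_mul, z 1 3 (by decide), z 2 4 (by decide)] at h3 h4
    refine mul_left_cancel₀ (mul_ne_zero n1 n2) ?_
    linear_combination hq / 2 - a * b * hα - a * c * hβ - b * α * h3 - c * β * h4
  have h13 : B (t 1) (t 3) = α * φ 3 (t 3) + γ * φ 5 (t 1) := by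
    obtain ⟨a, ha⟩ := expand (t 5) (htV 5)
    have n1 := div_ne_zero (nz 5 0 (by decide)) (nz 1 0 (by decide))
    have n2 := div_ne_zero (nz 5 2 (by decide)) (nz 3 2 (by decide))
    rw [z 5 1 (by decide), zero_div] at ha
    set b := φ 0 (t 5) / φ 0 (t 1)
    set c := φ 2 (t 5) / φ 2 (t 3)
    have hq := ht 5
    have h3 := z 5 3 (by decide)
    have h4 := z 5 5 (by decide)
    rw [ha, quad] at hq
    rw [ha] at h3 h4
    simp only [map_add, map_smul, smul_eq_mul, z 1 3 (by decide), z 3 5 (by decide)] at h3 h4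
    refine mul_left_cancel₀ (mul_ne_zero n1 n2) ?_
    linear_combination hq / 2 - a * b * hα - a * c * hγ - b * α * h3 - c * γ * h4
  have h23 : B (t 2) (t 3) = β * φ 4 (t 3) + γ * φ 5 (t 2) := by
    obtain ⟨a, ha⟩ := expand (t 4) (htV 4)
    have n1 := div_ne_zero (nz 4 1 (by decide)) (nz 2 1 (by decide))
    have n2 := div_ne_zero (nz 4 2 (by decide)) (nz 3 2 (by decide))
    rw [z 4 0 (by decide), zero_div] at ha
    set b := φ 1 (t 4) / φ 1 (t 2)
    set c := φ 2 (t 4) / φ 2 (t 3)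
    have hq := ht 4
    have h3 := z 4 4 (by decide)
    have h4 := z 4 5 (by decide)
    rw [ha, quad] at hq
    rw [ha] at h3 h4
    simp only [map_add, map_smul, smul_eq_mul, z 2 4 (by decide), z 3 5 (by decide)] at h3 h4
    refine mul_left_cancel₀ (mul_ne_zero n1 n2) ?_
    linear_combination hq / 2 - a * b * hβ - a * c * hγ - b * β * h3 - c * γ * h4
  obtain ⟨a, ha⟩ := expand (t 7) (htV 7)
  have n1 := div_ne_zero (nz 7 2 (by decide)) (nz 3 2 (by decide))
  have n2 := nz 7 5 (by decide)
  set b := φ 0 (t 7) / φ 0 (t 1)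
  set c := φ 1 (t 7) / φ 1 (t 2)
  set e := φ 2 (t 7) / φ 2 (t 3)
  have hq := ht 7
  have h3 := z 7 3 (by decide)
  have h4 := z 7 4 (by decide)
  have h5 : φ 5 (t 7) = φ 5 (t 7) := rfl
  rw [ha, quad] at hq
  rw [ha] at h3 h4
  nth_rw 2 [ha] at h5
  simp only [map_add, map_smul, smul_eq_mul, z 1 3 (by decide), z 2 4 (by decide),
    z 3 5 (by decide)] at h3 h4 h5
  -- At vertex `7` the functionals `φ 3` and `φ 4` vanish, while `e` and `φ 5` do not.
  have hγ0 : γ * (e * φ 5 (t 7)) = 0 := by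
    linear_combination hq / 2 - a * b * hα - a * c * hβ - a * e * hγ - b * c * h12 - b * e * h13 -
      c * e * h23 - b * α * h3 - c * β * h4 + e * γ * h5
  rw [hγ, (mul_eq_zero.1 hγ0).resolve_right (mul_ne_zero n1 n2), zero_mul]

end incidence

theorem not_null_of_incidence {d : ℕ} (V : Submodule ℝ (EuclideanSpace ℝ (Fin (d + 1))))
    (t : Fin 8 → EuclideanSpace ℝ (Fin (d + 1)))
    (φ : Fin 7 → EuclideanSpace ℝ (Fin (d + 1)) →ₗ[ℝ] ℝ) (htV : ∀ i, t i ∈ V)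
    (ht0 : ∀ i, t i ≠ 0) (hφ : ∀ i j, φ j (t i) = 0 ↔ i ∈ facetVerts j)
    (hinj : ∀ w ∈ V, φ 0 w = 0 → φ 1 w = 0 → φ 2 w = 0 → φ 3 w = 0 → w = 0) :
    ¬ ∀ i, lorentzForm d (t i) (t i) = 0 := by
  intro ht
  have h03 := orthogonal_of_incidence (lorentzForm d) lorentzForm_comm V t φ htV ht hφ hinj
  obtain ⟨c, hc⟩ := exists_smul_eq_of_null_of_orthogonal (ht 0) (ht 3) h03 (ht0 0)
  have h3 : φ 2 (t 3) ≠ 0 := mt (hφ 3 2).1 (by decide)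
  rw [hc, map_smul, (hφ 0 2).2 (by decide), smul_zero] at h3
  exact h3 rfl

/-! ### Hyperplanes of subspaces. -/

section subspaces

variable {E : Type*} [AddCommGroup E] [Module ℝ E] [FiniteDimensional ℝ E]

theorem le_sup_of_finrank_le_succ {H G U : Submodule ℝ E} (hHG : H ≤ G) (hUG : U ≤ G)
    (hU : ¬ U ≤ H) (hr : Module.finrank ℝ G ≤ Module.finrank ℝ H + 1) : G ≤ H ⊔ U := by
  have hlt : H < H ⊔ U := lt_of_le_of_ne le_sup_left fun h => hU (le_sup_right.trans h.ge)
  have := Submodule.finrank_lt_finrank_of_lt hlt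
  exact (Submodule.eq_of_le_of_finrank_le (sup_le hHG hUG) (by omega)).ge

theorem finrank_inf_lt {D H U : Submodule ℝ E} (hUD : U ≤ D) (hU : ¬ U ≤ H) :
    Module.finrank ℝ (D ⊓ H : Submodule ℝ E) < Module.finrank ℝ D :=
  Submodule.finrank_lt_finrank_of_lt
    (lt_of_le_of_ne inf_le_left fun h => hU (hUD.trans (h.ge.trans inf_le_right)))

/-- A hyperplane `H` of a subspace `G` is the kernel of a functional. -/
theorem exists_functional_of_finrank {H G : Submodule ℝ E} (hHG : ¬ G ≤ H) (hle : H ≤ G)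
    (hr : Module.finrank ℝ G ≤ Module.finrank ℝ H + 1) :
    ∃ φ : E →ₗ[ℝ] ℝ, ∀ w ∈ G, φ w = 0 ↔ w ∈ H := by
  obtain ⟨x, hxG, hxH⟩ := SetLike.not_le_iff_exists.1 hHG
  obtain ⟨φ, hφx, hφ⟩ := Submodule.exists_le_ker_of_notMem hxH
  refine ⟨φ, fun w hw => ⟨fun h0 => ?_, fun h => hφ h⟩⟩
  by_contra hwH
  have hG : G ≤ H ⊔ Submodule.span ℝ {w} := le_sup_of_finrank_le_succ hle
    ((Submodule.span_singleton_le_iff_mem _ _).2 hw)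
    (fun h => hwH ((Submodule.span_singleton_le_iff_mem _ _).1 h)) hr
  have hker : H ⊔ Submodule.span ℝ {w} ≤ LinearMap.ker φ :=
    sup_le hφ ((Submodule.span_singleton_le_iff_mem _ _).2 h0)
  exact hφx (hker (hG hxG))

end subspaces

/-! ### The case `k ≤ 1`: joins with `C`. -/

open CutFace in
/-- No representation of the faces of the join of `C` and a simplex has all subspaces of
dimension `k + 1` tangent to the light cone, if `k ≤ 1`. -/
theorem not_forall_isNullTangent_of_le_one {n k : ℕ} (hk : k ≤ 1) (hkn : k ≤ n)
    {W : CutFace → Finset (Fin n) → Submodule ℝ (EuclideanSpace ℝ (Fin (3 + n + 1)))}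
    (hW : ∀ a T b T', W a T ≤ W b T' ↔ a.verts ⊆ b.verts ∧ T ⊆ T') :
    ¬ ∀ a T, Module.finrank ℝ (W a T) = k + 1 → IsNullTangent (W a T) := by
  intro hT
  have hdim := finrank_eq_rank_add_card (by rw [finrank_euclideanSpace, Fintype.card_fin]; omega) hW
  obtain ⟨R, -, hR⟩ := Finset.exists_subset_card_eq (s := (Finset.univ : Finset (Fin n))) (n := k)
    (by simpa using hkn)
  have hWR : ∀ a b : CutFace, W a R ≤ W b R ↔ a.verts ⊆ b.verts := fun a b => by simp [hW]
  have hvert : ∀ i : Fin 8, Module.finrank ℝ (W (vertex i) R) = k + 1 := fun i => by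
    rw [hdim, hR, rank, add_comm]
  choose t htW ht0 htp using fun i => hT (vertex i) R (hvert i)
  have htt : ∀ i, lorentzForm (3 + n) (t i) (t i) = 0 := fun i => htp i _ (htW i)
  have hline : ∀ ρ ∈ W bot R, ρ ≠ 0 → W bot R ≤ Submodule.span ℝ {ρ} := by
    intro ρ hρ hρ0
    refine (Submodule.eq_of_le_of_finrank_le
      ((Submodule.span_singleton_le_iff_mem _ _).2 hρ) ?_).ge
    rw [finrank_span_singleton hρ0, hdim, hR, rank]
    omega
  have hgen : ∀ K : Submodule ℝ (EuclideanSpace ℝ (Fin (3 + n + 1))),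
      (∀ i, W (vertex i) R ≤ K) → W top R ≤ K := by
    intro K hK
    have step : ∀ (a b : CutFace) (i : Fin 8), a.verts ⊆ b.verts → i ∈ b.verts → i ∉ a.verts →
        b.rank = a.rank + 1 → W a R ≤ K → W b R ≤ K := by
      intro a b i hab hib hia hr ha
      refine (le_sup_of_finrank_le_succ ((hWR a b).2 hab) ((hWR (vertex i) b).2 ?_)
        (fun h => ?_) ?_).trans (sup_le ha (hK i))
      · simpa [verts] using hib
      · exact hia (by simpa [verts] using (hWR _ _).1 h)
      · rw [hdim, hdim, hr]
        omega
    have h1 := step (vertex 0) (edge 0) 1 (by decide) (by decide) (by decide) rfl (hK 0)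
    have h2 := step (edge 0) (facet 2) 2 (by decide) (by decide) (by decide) rfl h1
    exact step (facet 2) top 3 (by decide) (by decide) (by decide) rfl h2
  -- If `t i` lies in `W bot R`, every `t j` is orthogonal to it, hence proportional, so `t i` is
  -- orthogonal to `W top R`. By the same argument it lies in `W a ∅` for a face `a` of rank `k +
  -- 1`. Since `k ≤ 1`, it spans `W bot R`, which would then lie in `W a ∅`; this forces `R = ∅` and
  -- `t i = 0`.
  have htR : ∀ i, t i ∉ W bot R := by
    intro i hi
    have hperp : W top R ≤ LinearMap.ker (lorentzForm (3 + n) (t i)) := by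
      refine hgen _ fun j y hy => ?_
      have hij : lorentzForm (3 + n) (t j) (t i) = 0 :=
        htp j _ ((hWR bot (vertex j)).2 (by simp [verts]) hi)
      obtain ⟨c, hc⟩ := exists_smul_eq_of_null_of_orthogonal (htt j) (htt i) hij (ht0 j)
      rw [LinearMap.mem_ker, hc, map_smul, LinearMap.smul_apply, htp j y hy, smul_zero]
    obtain ⟨a, ha⟩ : ∃ a : CutFace, a.rank = k + 1 := by
      interval_cases k
      · exact ⟨vertex 0, rfl⟩
      · exact ⟨edge 0, rfl⟩
    obtain ⟨s, hs, hs0, hsp⟩ := hT a ∅ (by rw [hdim, ha, Finset.card_empty, add_zero])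
    have hsi : lorentzForm (3 + n) s (t i) = 0 := by
      rw [lorentzForm_comm]
      exact hperp ((hW a ∅ top R).2 ⟨by simp [verts], Finset.empty_subset _⟩ hs)
    obtain ⟨c, hc⟩ := exists_smul_eq_of_null_of_orthogonal (hsp s hs) (htt i) hsi hs0
    have hia : t i ∈ W a ∅ := hc ▸ Submodule.smul_mem _ c hs
    have hle := (hline _ hi (ht0 i)).trans ((Submodule.span_singleton_le_iff_mem _ _).2 hia)
    have hRe : R = ∅ := Finset.subset_empty.1 ((hW _ _ _ _).1 hle).2
    have hbot : W bot R = ⊥ := Submodule.finrank_eq_zero.1 (by rw [hdim, hRe]; rfl)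
    rw [hbot] at hi
    exact ht0 i hi
  have haniso : ∀ ρ ∈ W bot R, lorentzForm (3 + n) ρ ρ = 0 → ρ = 0 := by
    intro ρ hρ hρρ
    by_contra hρ0
    have h := htp 0 ρ ((hWR bot (vertex 0)).2 (by simp [verts]) hρ)
    rw [lorentzForm_comm] at h
    obtain ⟨c, hc⟩ := exists_smul_eq_of_null_of_orthogonal hρρ (htt 0) h hρ0
    exact htR 0 (hc ▸ Submodule.smul_mem _ c hρ)
  have hfun : ∀ j : Fin 7, ∃ φ : EuclideanSpace ℝ (Fin (3 + n + 1)) →ₗ[ℝ] ℝ,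
      ∀ w ∈ W top R, φ w = 0 ↔ w ∈ W (facet j) R := by
    intro j
    have hj : ∀ j : Fin 7, ¬ verts top ⊆ verts (facet j) := by decide
    refine exists_functional_of_finrank (fun h => hj j ((hWR _ _).1 h))
      ((hWR _ _).2 (by simp [verts])) ?_
    rw [hdim, hdim]
    simp only [rank]
    omega
  choose φ hφ using hfun
  have htG : ∀ i, t i ∈ W top R := fun i => (hWR (vertex i) top).2 (by simp [verts]) (htW i)
  -- As `W bot R` has no nonzero null vectors, it meets its orthogonal complement trivially. In that
  -- complement the `t i` stand for the vertices of `C`.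
  refine not_null_of_incidence (W top R ⊓ (lorentzForm (3 + n)).orthogonal (W bot R)) t φ
    (fun i => ⟨htG i, ?_⟩) ht0 (fun i j => ?_) ?_ htt
  · intro ρ hρ
    exact (lorentzForm_comm _ _).trans
      (htp i ρ ((hWR bot (vertex i)).2 (by simp [verts]) hρ))
  · rw [hφ j _ (htG i)]
    have hi : W (vertex i) R ≤ W bot R ⊔ Submodule.span ℝ {t i} :=
      le_sup_of_finrank_le_succ ((hWR _ _).2 (by simp [verts]))
        ((Submodule.span_singleton_le_iff_mem _ _).2 (htW i))
        (fun h => htR i ((Submodule.span_singleton_le_iff_mem _ _).1 h))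
        (by rw [hvert, hdim, hR, rank, zero_add])
    constructor
    · intro hij
      have := hi.trans (sup_le ((hWR bot (facet j)).2 (by simp [verts]))
        ((Submodule.span_singleton_le_iff_mem _ _).2 hij))
      simpa [verts] using (hWR _ _).1 this
    · intro hij
      exact (hWR (vertex i) (facet j)).2 (by simpa [verts] using hij) (htW i)
  · rintro w ⟨hwG, hwR⟩ h0 h1 h2 h3
    rw [hφ _ _ hwG] at h0 h1 h2 h3
    have vle : ∀ (i : Fin 8) (j : Fin 7), i ∈ facetVerts j → W (vertex i) R ≤ W (facet j) R :=
      fun i j h => (hWR _ _).2 (by simpa [verts] using h)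
    have nle : ∀ (i : Fin 8) (j : Fin 7), i ∉ facetVerts j → ¬ W (vertex i) R ≤ W (facet j) R :=
      fun i j h h' => h (by simpa [verts] using (hWR _ _).1 h')
    have top_le : ∀ i : Fin 8, W (vertex i) R ≤ W top R := fun i => (hWR _ _).2 (by simp [verts])
    -- Vertices `1`, `2`, `3`, `0` show that intersecting with facets `0`, `1`, `2`, `3` lowers the
    -- dimension each time, from `4 + k` to at most `k`. Only `W bot R` remains.
    have l0 := finrank_inf_lt (top_le 1) (nle 1 0 (by decide))
    have l1 := finrank_inf_lt (le_inf (top_le 2) (vle 2 0 (by decide))) (nle 2 1 (by decide))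
    have l2 := finrank_inf_lt (le_inf (le_inf (top_le 3) (vle 3 0 (by decide)))
      (vle 3 1 (by decide))) (nle 3 2 (by decide))
    have l3 := finrank_inf_lt (le_inf (le_inf (le_inf (top_le 0) (vle 0 0 (by decide)))
      (vle 0 1 (by decide))) (vle 0 2 (by decide))) (nle 0 3 (by decide))
    have htop : Module.finrank ℝ (W top R) = 4 + k := by rw [hdim, hR, rank]
    have hbot : Module.finrank ℝ (W bot R) = k := by rw [hdim, hR, rank, zero_add]
    have hb : ∀ b : CutFace, W bot R ≤ W b R := fun b => (hWR _ _).2 (by simp [verts])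
    have heq := Submodule.eq_of_le_of_finrank_le (le_inf (le_inf (le_inf (le_inf (hb top)
      (hb (facet 0))) (hb (facet 1))) (hb (facet 2))) (hb (facet 3))) (by omega)
    have hw : w ∈ W bot R := by
      rw [heq]
      exact ⟨⟨⟨⟨hwG, h0⟩, h1⟩, h2⟩, h3⟩
    exact haniso w hw (hwR w hw)

/-! ### The case `2 ≤ k`: joins with the polar of `C`. -/

open CutFace in
/-- No representation of the faces of the join of the polar of `C` and a simplex has all
subspaces of dimension `k + 1` tangent to the light cone, if `2 ≤ k`. -/
theorem not_forall_isNullTangent_of_two_le {n k : ℕ} (hk : 2 ≤ k) (hkn : k ≤ n + 2)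
    {W : CutFace → Finset (Fin n) → Submodule ℝ (EuclideanSpace ℝ (Fin (3 + n + 1)))}
    (hW : ∀ a T b T', W a T ≤ W b T' ↔ b.verts ⊆ a.verts ∧ T ⊆ T') :
    ¬ ∀ a T, Module.finrank ℝ (W a T) = k + 1 → IsNullTangent (W a T) := by
  intro hT
  have hdim := finrank_eq_corank_add_card
    (by rw [finrank_euclideanSpace, Fintype.card_fin]; omega) hW
  obtain ⟨R, -, hR⟩ := Finset.exists_subset_card_eq (s := (Finset.univ : Finset (Fin n)))
    (n := k - 2) (by rw [Finset.card_univ, Fintype.card_fin]; omega)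
  have hWR : ∀ a b : CutFace, W a R ≤ W b R ↔ b.verts ⊆ a.verts := fun a b => by simp [hW]
  have hvert : ∀ i : Fin 8, Module.finrank ℝ (W (vertex i) R) = k + 1 := fun i => by
    rw [hdim, hR, rank]
    omega
  have hG : Module.finrank ℝ (W bot R) = k + 2 := by
    rw [hdim, hR, rank]
    omega
  have vle : ∀ i : Fin 8, W (vertex i) R ≤ W bot R := fun i => (hWR _ _).2 (by simp [verts])
  have fle : ∀ j : Fin 7, W (facet j) ∅ ≤ W bot R := fun j => (hW _ _ _ _).2 (by simp [verts])
  have fle_vertex : ∀ (i : Fin 8) (j : Fin 7), i ∈ facetVerts j →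
      W (facet j) ∅ ≤ W (vertex i) R := fun i j h => (hW _ _ _ _).2 (by simpa [verts] using h)
  have not_fle : ∀ (i : Fin 8) (j : Fin 7), i ∉ facetVerts j →
      ¬ W (facet j) ∅ ≤ W (vertex i) R := fun i j h h' =>
    h (by simpa [verts] using ((hW _ _ _ _).1 h').1)
  -- A radical vector `w` is null and orthogonal to the tangent vector of every subspace of
  -- dimension `k + 1` in `W bot R`, hence lies in all of them. Enough of these are intersected to
  -- reach zero.
  have hnondeg : ∀ w ∈ W bot R, W bot R ≤ LinearMap.ker (lorentzForm (3 + n) w) → w = 0 := by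
    intro w hw hwp
    by_contra hw0
    have hmem : ∀ a T, W a T ≤ W bot R → Module.finrank ℝ (W a T) = k + 1 → w ∈ W a T := by
      intro a T hle hr
      obtain ⟨s, hs, hs0, hsp⟩ := hT a T hr
      have hsw : lorentzForm (3 + n) s w = 0 := (lorentzForm_comm _ _).trans (hwp (hle hs))
      obtain ⟨c, hc⟩ := exists_smul_eq_of_null_of_orthogonal (hsp s hs) (hwp hw) hsw hs0
      exact hc ▸ Submodule.smul_mem _ c hs
    have hwv : ∀ i, w ∈ W (vertex i) R := fun i => hmem _ _ (vle i) (hvert i)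
    set D : Finset (Fin n) → Submodule ℝ (EuclideanSpace ℝ (Fin (3 + n + 1))) :=
      fun S => W bot R ⊓ S.inf fun r => W bot (R.erase r) with hD
    have hDr : ∀ S ⊆ R, Module.finrank ℝ (D S) + S.card ≤ k + 2 := by
      intro S
      induction S using Finset.induction_on with
      | empty =>
        intro _
        have hD0 : D ∅ = W bot R := by simp [hD]
        rw [hD0, hG, Finset.card_empty]
      | insert r S hr ih =>
        intro hS
        have hrR := hS (Finset.mem_insert_self r S)
        have h1 := ih ((Finset.subset_insert r S).trans hS)
        have hins : D (insert r S) = D S ⊓ W bot (R.erase r) := by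
          simp only [hD, Finset.inf_insert]
          rw [inf_left_comm, inf_comm]
        have h2 : W top {r} ≤ D S := by
          refine le_inf ((hW _ _ _ _).2 ⟨by simp [verts], by simpa using hrR⟩)
            (Finset.le_inf fun r' hr' => (hW _ _ _ _).2 ⟨by simp [verts], ?_⟩)
          rw [Finset.singleton_subset_iff, Finset.mem_erase]
          exact ⟨fun h => hr (h ▸ hr'), hrR⟩
        -- The simplex vertex `r` lies in all subspaces used so far but not in the new one. The `k -
        -- 2` vertices of `R` bring the dimension from `k + 2` down to at most `4`.
        have h3 := finrank_inf_lt (H := W bot (R.erase r)) h2 (by simp [hW])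
        rw [hins, Finset.card_insert_of_notMem hr]
        omega
    have hDR := hDr R subset_rfl
    have fD : ∀ j : Fin 7, W (facet j) ∅ ≤ D R := fun j =>
      le_inf (fle j) (Finset.le_inf fun r _ => (hW _ _ _ _).2 (by simp [verts]))
    have l0 := finrank_inf_lt (fD 0) (not_fle 1 0 (by decide))
    have l1 := finrank_inf_lt (le_inf (fD 3) (fle_vertex 1 3 (by decide)))
      (not_fle 0 3 (by decide))
    have l2 := finrank_inf_lt (le_inf (le_inf (fD 1) (fle_vertex 1 1 (by decide)))
      (fle_vertex 0 1 (by decide))) (not_fle 2 1 (by decide))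
    have l3 := finrank_inf_lt (le_inf (le_inf (le_inf (fD 2) (fle_vertex 1 2 (by decide)))
      (fle_vertex 0 2 (by decide))) (fle_vertex 2 2 (by decide))) (not_fle 3 2 (by decide))
    have hwD : w ∈ D R := by
      refine ⟨hw, (Submodule.mem_finsetInf).2 fun r hr => hmem _ _ ?_ ?_⟩
      · exact (hW _ _ _ _).2 ⟨subset_rfl, Finset.erase_subset _ _⟩
      · have := Finset.card_pos.2 ⟨r, hr⟩
        rw [hdim, Finset.card_erase_of_mem hr, hR, rank]
        omega
    have hbot := Submodule.finrank_eq_zero.1 (show Module.finrank ℝ (D R ⊓ W (vertex 1) R ⊓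
      W (vertex 0) R ⊓ W (vertex 2) R ⊓ W (vertex 3) R :
        Submodule ℝ (EuclideanSpace ℝ (Fin (3 + n + 1)))) = 0 by omega)
    have hwbot : w ∈ (⊥ : Submodule ℝ (EuclideanSpace ℝ (Fin (3 + n + 1)))) := by
      rw [← hbot]
      exact ⟨⟨⟨⟨hwD, hwv 1⟩, hwv 0⟩, hwv 2⟩, hwv 3⟩
    exact hw0 hwbot
  choose t htW ht0 htp using fun i => hT (vertex i) R (hvert i)
  have htt : ∀ i, lorentzForm (3 + n) (t i) (t i) = 0 := fun i => htp i _ (htW i)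
  have hline : ∀ j : Fin 7, ∃ u, W (facet j) ∅ = Submodule.span ℝ {u} := by
    intro j
    obtain ⟨u, -, hu⟩ := finrank_eq_one_iff'.1 (show Module.finrank ℝ (W (facet j) ∅) = 1 by
      rw [hdim, rank, Finset.card_empty])
    refine ⟨u, le_antisymm (fun x hx => ?_) ((Submodule.span_singleton_le_iff_mem _ _).2 u.2)⟩
    obtain ⟨c, hc⟩ := hu ⟨x, hx⟩
    exact Submodule.mem_span_singleton.2 ⟨c, congrArg Subtype.val hc⟩
  choose u hu using hline
  have hker : ∀ (j : Fin 7) (w), lorentzForm (3 + n) (u j) w = 0 ↔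
      W (facet j) ∅ ≤ LinearMap.ker (lorentzForm (3 + n) w) := by
    intro j w
    rw [hu, Submodule.span_singleton_le_iff_mem, LinearMap.mem_ker, lorentzForm_comm]
  refine not_null_of_incidence (W bot R ⊓ (lorentzForm (3 + n)).orthogonal (W top R)) t
    (fun j => lorentzForm (3 + n) (u j)) (fun i => ⟨vle i (htW i), fun ρ hρ => ?_⟩) ht0
    (fun i j => ?_) ?_ htt
  · exact (lorentzForm_comm _ _).trans
      (htp i ρ ((hWR top (vertex i)).2 (by simp [verts]) hρ))
  · rw [hker]
    -- If `u j` is outside the hyperplane `W (vertex i) R` but orthogonal to `t i`, then `t i` is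
    -- orthogonal to all of `W bot R`, against nondegeneracy.
    refine ⟨fun h => ?_, fun h y hy => htp i y (fle_vertex i j h hy)⟩
    by_contra hij
    have := le_sup_of_finrank_le_succ (vle i) (fle j) (not_fle i j hij) (by rw [hG, hvert])
    exact ht0 i (hnondeg _ (vle i (htW i)) (this.trans (sup_le (fun y hy => htp i y hy) h)))
  · rintro w ⟨hwG, hwR⟩ h0 h1 h2 h3
    rw [hker] at h0 h1 h2 h3
    -- Orthogonality to `w` is carried along a flag from `W top R` to `W bot R`, each step adding
    -- one of the lines for the facets `1`, `2`, `0`, `3`.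
    have step : ∀ (a b : CutFace) (j : Fin 7), b.verts ⊆ a.verts → b.verts ⊆ facetVerts j →
        ¬ a.verts ⊆ facetVerts j → a.rank = b.rank + 1 →
        W a R ≤ LinearMap.ker (lorentzForm (3 + n) w) →
        W (facet j) ∅ ≤ LinearMap.ker (lorentzForm (3 + n) w) →
        W b R ≤ LinearMap.ker (lorentzForm (3 + n) w) := by
      intro a b j hab hbj haj hr ha hj
      refine (le_sup_of_finrank_le_succ ((hWR a b).2 hab)
        ((hW (facet j) ∅ b R).2 ⟨hbj, Finset.empty_subset _⟩)
        (fun h => haj ((hW _ _ _ _).1 h).1) ?_).trans (sup_le ha hj)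
      rw [hdim, hdim]
      omega
    have htop : W top R ≤ LinearMap.ker (lorentzForm (3 + n) w) := fun ρ hρ =>
      (lorentzForm_comm _ _).trans (hwR ρ hρ)
    have g1 := step top (facet 1) 1 (by decide) (by decide) (by decide) rfl htop h1
    have g2 := step (facet 1) (edge 0) 2 (by decide) (by decide) (by decide) rfl g1 h2
    have g3 := step (edge 0) (vertex 0) 0 (by decide) (by decide) (by decide) rfl g2 h0
    exact hnondeg w hwG (step (vertex 0) bot 3 (by decide) (by decide) (by decide) rfl g3 h3)

/-! ### Integer coordinates for `C` and its polar. -/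

/-- Points of `ℝ³` with coordinates in `D⁻¹ℤ`. -/
noncomputable def ratPoint {m : ℕ} (D : ℤ) (v : Fin m → Fin 3 → ℤ) (i : Fin m) (s : Fin 3) : ℝ :=
  v i s / D

theorem sum_mul_ratPoint {m l : ℕ} {D : ℤ} (hD : 0 < D) (v : Fin m → Fin 3 → ℤ)
    (a : Fin l → Fin 3 → ℤ) (b : Fin l → ℤ) (i : Fin m) (j : Fin l) :
    ∑ s, (a j s : ℝ) * ratPoint D v i s + b j =
      ((a j 0 * v i 0 + a j 1 * v i 1 + a j 2 * v i 2 + D * b j : ℤ) : ℝ) / D := by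
  have : (D : ℝ) ≠ 0 := by exact_mod_cast hD.ne'
  rw [Fin.sum_univ_three]
  simp only [ratPoint]
  push_cast
  field_simp

theorem nonneg_ratPoint {m l : ℕ} {D : ℤ} (hD : 0 < D) {v : Fin m → Fin 3 → ℤ}
    {a : Fin l → Fin 3 → ℤ} {b : Fin l → ℤ}
    (h : ∀ i j, 0 ≤ a j 0 * v i 0 + a j 1 * v i 1 + a j 2 * v i 2 + D * b j) (i : Fin m)
    (j : Fin l) : 0 ≤ ∑ s, (a j s : ℝ) * ratPoint D v i s + b j := by
  rw [sum_mul_ratPoint hD]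
  exact div_nonneg (Int.cast_nonneg (h i j)) (Int.cast_nonneg hD.le)

theorem eq_zero_ratPoint_iff {m l : ℕ} {D : ℤ} (hD : 0 < D) (v : Fin m → Fin 3 → ℤ)
    (a : Fin l → Fin 3 → ℤ) (b : Fin l → ℤ) (i : Fin m) (j : Fin l) :
    ∑ s, (a j s : ℝ) * ratPoint D v i s + b j = 0 ↔
      a j 0 * v i 0 + a j 1 * v i 1 + a j 2 * v i 2 + D * b j = 0 := by
  rw [sum_mul_ratPoint hD, div_eq_zero_iff, or_iff_left (by exact_mod_cast hD.ne'),
    Int.cast_eq_zero]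

theorem ratPoint_eq_single {m : ℕ} {D : ℤ} (hD : 0 < D) {v : Fin m → Fin 3 → ℤ} {i : Fin m}
    {s : Fin 3} (h : ∀ s', v i s' = if s' = s then D else 0) : ratPoint D v i = Pi.single s 1 := by
  have : (D : ℝ) ≠ 0 := by exact_mod_cast hD.ne'
  ext s'
  rw [ratPoint, h, Pi.single_apply]
  split_ifs <;> simp [this]

theorem ratPoint_add_eq_zero {m : ℕ} (D : ℤ) {v : Fin m → Fin 3 → ℤ} {i i' : Fin m}
    (h : ∀ s, v i' s = -v i s) : ratPoint D v i + ratPoint D v i' = 0 := by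
  ext s
  simp [ratPoint, h, neg_div]

/-- Twice the vertices of `C`. -/
def cutCubeVertex : Fin 8 → Fin 3 → ℤ :=
  ![![0, 0, 0], ![2, 0, 0], ![0, 2, 0], ![0, 0, 2], ![0, 2, 2], ![2, 0, 2], ![2, 2, 0],
    ![2, 2, 1]]

/-- The linear parts of the functionals that define the facets of `C`. -/
def cutCubeNormal : Fin 7 → Fin 3 → ℤ :=
  ![![1, 0, 0], ![0, 1, 0], ![0, 0, 1], ![-1, 0, 0], ![0, -1, 0], ![0, 0, -1], ![-1, -1, -2]]

/-- The constant terms of the functionals that define the facets of `C`. -/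
def cutCubeConst : Fin 7 → ℤ := ![0, 0, 0, 1, 1, 1, 3]

theorem cutCube_incidence : ∀ i j, cutCubeNormal j 0 * cutCubeVertex i 0 +
    cutCubeNormal j 1 * cutCubeVertex i 1 + cutCubeNormal j 2 * cutCubeVertex i 2 +
    2 * cutCubeConst j = 0 ↔ i ∈ facetVerts j := by decide

/-- Four times the vertices of a polar of `C`, an octahedron with a vertex added. -/
def polarVertex : Fin 7 → Fin 3 → ℤ :=
  ![![-4, 0, 0], ![0, -4, 0], ![0, 0, -4], ![4, 0, 0], ![0, 4, 0], ![0, 0, 4], ![1, 1, 4]]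

/-- The linear parts of the functionals that define the facets of the polar of `C`. -/
def polarNormal : Fin 8 → Fin 3 → ℤ :=
  ![![1, 1, 1], ![-1, 1, 1], ![1, -1, 1], ![1, 1, -1], ![1, -1, -1], ![-1, 1, -1], ![-1, -1, 1],
    ![-2, -2, -1]]

/-- The constant terms of the functionals that define the facets of the polar of `C`. -/
def polarConst : Fin 8 → ℤ := ![1, 1, 1, 1, 1, 1, 1, 2]

theorem polar_incidence : ∀ j i, polarNormal i 0 * polarVertex j 0 +
    polarNormal i 1 * polarVertex j 1 + polarNormal i 2 * polarVertex j 2 +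
    4 * polarConst i = 0 ↔ i ∈ facetVerts j := by decide

/-! ### The two families and the conclusion. -/

theorem not_hasTangentRealization_join_cutCube {n k : ℕ} (hk : k ≤ 1) (hkn : k ≤ n) :
    ¬ HasTangentRealization k
      (convexHull ℝ (Set.range (joinPoint n (ratPoint 2 cutCubeVertex)))) := by
  rintro ⟨W, hW, hT⟩
  obtain ⟨F, hF⟩ := exists_faces_join n (nonneg_ratPoint two_pos (v := cutCubeVertex)
    (a := cutCubeNormal) (b := cutCubeConst) (by decide))
  refine not_forall_isNullTangent_of_le_one (W := fun a T => W (F a.facets T)) hk hkn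
    (fun a T b T' => ?_) fun a T => hT _
  simp only [hW, hF, eq_zero_ratPoint_iff two_pos, cutCube_incidence,
    ← CutFace.mem_verts_iff, Finset.subset_iff]

theorem not_hasTangentRealization_join_polar {n k : ℕ} (hk : 2 ≤ k) (hkn : k ≤ n + 2) :
    ¬ HasTangentRealization k
      (convexHull ℝ (Set.range (joinPoint n (ratPoint 4 polarVertex)))) := by
  rintro ⟨W, hW, hT⟩
  obtain ⟨F, hF⟩ := exists_faces_join n (nonneg_ratPoint four_pos (v := polarVertex)
    (a := polarNormal) (b := polarConst) (by decide))
  -- Vertices of `C` index the facets of the polar, so `a.verts` cuts out the face dual to `a`.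
  refine not_forall_isNullTangent_of_two_le (W := fun a T => W (F a.verts T)) hk hkn
    (fun a T b T' => ?_) fun a T => hT _
  simp only [hW, hF, eq_zero_ratPoint_iff four_pos, polar_incidence, ← CutFace.mem_facets_iff]
  refine and_congr_left fun _ => ⟨fun h i hi => ?_, fun h j hj => ?_⟩
  · rw [CutFace.mem_verts_iff] at hi ⊢
    exact fun j hj => hi j (h j hj)
  · rw [CutFace.mem_facets_iff] at hj ⊢
    exact fun i hi => hj i (h hi)

theorem theorem1p4 (d k : ℕ) (hd : 3 ≤ d) (hk : k ≤ d - 1) (hdk : ¬(d = 3 ∧ k = 1)) :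
    ∃ P : Set (EuclideanSpace ℝ (Fin d)),
      IsPolytope P ∧ ¬ IsWeaklyScribable k P ∧ ¬ IsEuclideanWeaklyScribable k P := by
  suffices h : ∃ P : Set (EuclideanSpace ℝ (Fin d)),
      IsPolytope P ∧ ¬ HasTangentRealization k P by
    obtain ⟨P, hP, hk⟩ := h
    exact ⟨P, hP, fun h => hk h.hasTangentRealization, fun h => hk h.hasTangentRealization⟩
  obtain ⟨n, rfl⟩ := Nat.exists_eq_add_of_le hd
  -- The first construction needs a simplex face with `k` vertices, that is `k ≤ n`; for `k ≤ 1`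
  -- this fails only for `n = 0`, `k = 1`, the excluded case.
  rcases Nat.lt_or_ge k 2 with hk2 | hk2
  · exact ⟨_, isPolytope_join n ⟨0, 0, ratPoint_add_eq_zero 2 (by decide)⟩
        (fun s => ⟨![1, 2, 3] s, ratPoint_eq_single two_pos (by decide +revert)⟩),
      not_hasTangentRealization_join_cutCube (by omega) (by omega)⟩
  · exact ⟨_, isPolytope_join n ⟨0, 3, ratPoint_add_eq_zero 4 (by decide)⟩
        (fun s => ⟨![3, 4, 5] s, ratPoint_eq_single four_pos (by decide +revert)⟩),
      not_hasTangentRealization_join_polar hk2 (by omega)⟩
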